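/- Let $0\le k\le n$ and let $E\subset\mathbb R^n$ be the closure of a bounded Lipschitz domain, i.e. of a nonempty bounded open set which near each boundary point is, in a suitable orthonormal frame, the strict epigraph of a Lipschitz function. Let $\Lambda_k$ be the $k$-th exterior power of $\mathbb R^n$ with its Euclidean norm (the vectors $e_{\alpha(1)}\wedge\dots\wedge e_{\alpha(k)}$, $\alpha$ increasing, are orthonormal), let $\Lambda^k=(\Lambda_k)^*$, and let $\mathcal H^k$ be the $k$-dimensional Hausdorff measure. An $\mathcal H^k$-measurable set $S\subseteq E$ with $0<\mathcal H^k(S)<\infty$ is $k$-rectifiable if it is covered, up to an $\mathcal H^k$-null set, by countably many Lipschitz images of $\mathbb R^k$. It is oriented by $\tau:S\to\Lambda_k$ if, up to an $\mathcal H^k$-null set $S_{\mathrm{sing}}$, it is a countable disjoint union $S_{\mathrm{reg}}$ of measurable pieces of $k$-dimensional embedded $\mathscr C^1$ submanifolds of $\mathbb R^n$, such that $\tau$ is continuous on $S_{\mathrm{reg}}$ and, at every point of $S_{\mathrm{reg}}$, is a unit simple $k$-vector spanning the tangent space. For $\omega\in\mathscr C^0(E,\Lambda^k)$ put $\int_S\omega=\int_S\langle\omega(x);\tau(x)\rangle\,d\mathcal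 H^k(x)$ and $T_S(\omega)=\mathcal H^k(S)^{-1}\int_S\omega$. Let $\mathscr A^k(E)$ be the set of all these averaging currents $T_S$, and let $$\|\omega\|_0=\sup_{S}\frac1{\mathcal H^k(S)}\Big|\int_S\omega\Big|,$$ the supremum being over all oriented $k$-rectifiable sets $S\subseteq E$ as above. The support $\operatorname{supp}T$ of a linear functional $T$ on $\mathscr C^0(E,\Lambda^k)$ is the complement in $E$ of the union of all relatively open sets $A\subseteq E$ such that $T(\omega)=0$ for every $\omega$ whose support is contained in $A$. Let $\mathscr V(E)$ be an $N$-dimensional linear subspace of $\mathscr C^0(E,\Lambda^k)$ and let $\mathcal T=\{T_1,\dots,T_N\}\subset\mathscr A^k(E)$ be unisolvent for $\mathscr V(E)$, i.e. if $\omega\in\mathscr V(E)$ and $T_i(\omega)=0$ for all $i$, then $\omega=0$. Let $\omega_1,\dots,\omega_N\in\mathscr V(E)$ be the Lagrange basis, $T_i(\omega_j)=\delta_{ij}$, let $\Pi:\mathscr C^0(E,\Lambda^k)\to\mathscr V(E)$ be the interpolation operator, determined by $T_i(\Pi\omega)=T_i(\omega)$ for all $i$ (so $\Pi\omega=\sum_iT_i(\omega)\,\omega_i$),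 and put $$\|\Pi\|_{\mathrm{op}}=\sup_{\|\omega\|_0\ne0}\frac{\|\Pi\omega\|_0}{\|\omega\|_0},\qquad \mathcal L=\sup_{T\in\mathscr A^k(E)}\sum_{i=1}^N|T(\omega_i)|.$$ Then $\mathcal L<\infty$ and $\|\Pi\|_{\mathrm{op}}\le\mathcal L$. If moreover $\mathcal H^k(\operatorname{supp}T_i\cap\operatorname{supp}T_j)=0$ for all $i\ne j$, then $\|\Pi\|_{\mathrm{op}}=\mathcal L$. -/

import Mathlib

open MeasureTheory
open scoped ENNReal

noncomputable section

namespace IntegralInterpolation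

/-- Euclidean `n`-space. -/
abbrev Rn (n : ℕ) : Type := EuclideanSpace ℝ (Fin n)

/-! ### Multivectors and covectors -/

/-- The space `Λ_k` of `k`-vectors of `ℝⁿ` with its Euclidean norm: the exterior power
`⋀[ℝ]^k ℝⁿ`, written in coordinates with respect to the basis
`e_α = e_{α(1)} ∧ ⋯ ∧ e_{α(k)}`, `α` increasing, which is declared to be orthonormal.
An increasing multi-index is given by its range, a `k`-element subset of `Fin n`. -/
abbrev KVector (n k : ℕ) : Type := EuclideanSpace ℝ (Set.powersetCard (Fin n) k)

/-- The identification of Mathlib's exterior power `⋀[ℝ]^k ℝⁿ` with `KVector n k`. -/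
def exteriorPowerEquiv (n k : ℕ) : (⋀[ℝ]^k (Rn n)) ≃ₗ[ℝ] KVector n k :=
  (((EuclideanSpace.basisFun (Fin n) ℝ).toBasis).exteriorPower k).equivFun ≪≫ₗ
    (WithLp.linearEquiv 2 ℝ (Set.powersetCard (Fin n) k → ℝ)).symm

/-- The wedge product `v₁ ∧ ⋯ ∧ v_k`. -/
def wedge {n k : ℕ} (v : Fin k → Rn n) : KVector n k :=
  exteriorPowerEquiv n k (exteriorPower.ιMulti ℝ k v)

/-- The space `Λ^k = (Λ_k)^*` of `k`-covectors; the pairing `⟨ω; τ⟩` is `ω τ`. -/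
abbrev KCovector (n k : ℕ) : Type := StrongDual ℝ (KVector n k)

/-! ### Domains and forms -/

/-- Bounded Lipschitz domain: a nonempty bounded open set that, near each of its boundary points
and for a suitable unit vector `u`, is the strict epigraph, in the direction `u`, of a Lipschitz
function on the hyperplane orthogonal to `u`. (Connectedness is not required.) -/
structure IsBoundedLipschitzDomain {n : ℕ} (Ω : Set (Rn n)) : Prop where
  isOpen : IsOpen Ω
  nonempty : Ω.Nonempty
  isBounded : Bornology.IsBounded Ω
  locally_epigraph : ∀ x ∈ frontier Ω, ∃ (u : Rn n) (K : NNReal)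
    (g : (Submodule.span ℝ {u})ᗮ → ℝ) (U : Set (Rn n)),
    ‖u‖ = 1 ∧ LipschitzWith K g ∧ IsOpen U ∧ x ∈ U ∧
    Ω ∩ U = {y ∈ U | g ((Submodule.span ℝ {u})ᗮ.orthogonalProjectionOnto y) < inner ℝ u y}

/-- The vector space `𝒞⁰(E, Λ^k)` of continuous `k`-forms on `E`. -/
abbrev TestForm {n : ℕ} (k : ℕ) (E : Set (Rn n)) : Type := C(E, KCovector n k)

/-- Extension of a form by zero outside `E`; only values on `E` are ever used. -/
def TestForm.extend {n k : ℕ} {E : Set (Rn n)} (ω : TestForm k E) : Rn n → KCovector n k :=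
  Function.extend Subtype.val ω 0

/-! ### Rectifiable sets and orientations -/

/-- `S` is `k`-rectifiable: up to an `ℋ^k`-null set it is covered by countably many Lipschitz
images of `ℝ^k`. -/
def IsRectifiable {n : ℕ} (k : ℕ) (S : Set (Rn n)) : Prop :=
  ∃ f : ℕ → Rn k → Rn n, (∀ j, ∃ K : NNReal, LipschitzWith K (f j)) ∧
    μHE[k] (S \ ⋃ j, Set.range (f j)) = 0

/-- On the open neighbourhood `U` of `x`, the set `M` is the zero set of the `𝒞¹` submersion `F`
with values in `ℝ^{n-k}`. -/
structure IsDefiningMapAt {n : ℕ} (k : ℕ) (M : Set (Rn n)) (x : Rn n) (U : Set (Rn n))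
    (F : Rn n → Rn (n - k)) : Prop where
  isOpen : IsOpen U
  mem : x ∈ U
  contDiffOn : ContDiffOn ℝ 1 F U
  surjective : ∀ y ∈ U, Function.Surjective (fderiv ℝ F y)
  inter_eq : M ∩ U = {y ∈ U | F y = 0}

/-- `M` is a `k`-dimensional embedded submanifold of `ℝⁿ` (`k ≤ n`) of class `𝒞¹`. -/
def IsC1Submanifold {n : ℕ} (k : ℕ) (M : Set (Rn n)) : Prop :=
  ∀ x ∈ M, ∃ U F, IsDefiningMapAt k M x U F

/-- `W` is the tangent space at `x` of the `k`-dimensional `𝒞¹` submanifold `M`. -/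
def IsTangentSpace {n : ℕ} (k : ℕ) (M : Set (Rn n)) (x : Rn n) (W : Submodule ℝ (Rn n)) : Prop :=
  ∃ U F, IsDefiningMapAt k M x U F ∧ W = LinearMap.ker (fderiv ℝ F x : Rn n →ₗ[ℝ] Rn (n - k))

/-- The `k`-vector field `τ` is an orientation of `S`. The regular part of `S` is `⋃ j, R j`, a
countable disjoint union of measurable pieces `R j` of `𝒞¹` submanifolds `M j`, and the singular
part is its complement in `S`, an `ℋ^k`-null set. On the regular part, `τ` is continuous and is a
unit simple `k`-vector that spans the tangent space. The scalar `c` matters for `k = 0` only, where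
the unit simple `0`-vectors are `1` and `-1`. -/
def IsOrientation {n : ℕ} (k : ℕ) (S : Set (Rn n)) (τ : Rn n → KVector n k) : Prop :=
  ∃ R M : ℕ → Set (Rn n),
    (∀ j, IsC1Submanifold k (M j)) ∧
    (∀ j, R j ⊆ M j) ∧
    (∀ j, NullMeasurableSet (R j) μHE[k]) ∧
    Pairwise (Function.onFun Disjoint R) ∧
    (∀ j, R j ⊆ S) ∧
    μHE[k] (S \ ⋃ j, R j) = 0 ∧
    ContinuousOn τ (⋃ j, R j) ∧
    ∀ j, ∀ x ∈ R j, ‖τ x‖ = 1 ∧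
      ∃ (c : ℝ) (v : Fin k → Rn n), τ x = c • wedge v ∧ LinearIndependent ℝ v ∧
        IsTangentSpace k (M j) x (Submodule.span ℝ (Set.range v))

/-- `S ⊆ E` is an `ℋ^k`-measurable `k`-rectifiable set of positive finite `ℋ^k`-measure, oriented
by `τ`. -/
structure IsOrientedRectifiable {n : ℕ} (k : ℕ) (E S : Set (Rn n)) (τ : Rn n → KVector n k) :
    Prop where
  subset : S ⊆ E
  nullMeasurable : NullMeasurableSet S μHE[k]
  rectifiable : IsRectifiable k S
  measure_pos : 0 < (μHE[k] : Measure (Rn n)) S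
  measure_lt_top : (μHE[k] : Measure (Rn n)) S < ∞
  orientation : IsOrientation k S τ

/-- The integral `∫_S ω = ∫_S ⟨ω(x); τ(x)⟩ dℋ^k(x)` of a form. -/
def formIntegral {n k : ℕ} {E : Set (Rn n)} (S : Set (Rn n)) (τ : Rn n → KVector n k)
    (ω : TestForm k E) : ℝ :=
  ∫ x in S, ω.extend x (τ x) ∂μHE[k]

/-- The norm `‖ω‖₀ = sup_S ℋ^k(S)⁻¹ |∫_S ω|`, as an extended nonnegative real. -/
def norm0 {n k : ℕ} {E : Set (Rn n)} (ω : TestForm k E) : ℝ≥0∞ :=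
  ⨆ (S : Set (Rn n)) (τ : Rn n → KVector n k) (_ : IsOrientedRectifiable k E S τ),
    ENNReal.ofReal |formIntegral S τ ω| / (μHE[k] : Measure (Rn n)) S

/-! ### Averaging currents -/

/-- The set `𝒜^k(E)` of averaging currents `T_S(ω) = ℋ^k(S)⁻¹ ∫_S ω`. -/
def averagingCurrents {n : ℕ} (k : ℕ) (E : Set (Rn n)) : Set (TestForm k E →ₗ[ℝ] ℝ) :=
  {T | ∃ S τ, IsOrientedRectifiable k E S τ ∧
    ∀ ω, T ω = ((μHE[k] : Measure (Rn n)) S).toReal⁻¹ * formIntegral S τ ω}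

/-- The support of a current: the complement in `E` of the union of all (relatively) open sets `A`
such that `T` vanishes on every form supported in `A`. -/
def currentSupport {n k : ℕ} {E : Set (Rn n)} (T : TestForm k E →ₗ[ℝ] ℝ) : Set (Rn n) :=
  Subtype.val '' (⋃₀ {A : Set E | IsOpen A ∧ ∀ ω : TestForm k E, tsupport ω ⊆ A → T ω = 0})ᶜ

/-! ### Interpolation -/

section Interpolation

variable {n k N : ℕ} {E : Set (Rn n)} {V : Submodule ℝ (TestForm k E)}
  {T : Fin N → TestForm k E →ₗ[ℝ] ℝ}

/-- `{T₁, …, T_N}` is unisolvent for `V`: the dimension of `V` is `N` and the only element of `V` on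
which all the `T_i` vanish is zero. -/
structure IsUnisolvent (V : Submodule ℝ (TestForm k E)) (T : Fin N → TestForm k E →ₗ[ℝ] ℝ) :
    Prop where
  finite : Module.Finite ℝ V
  finrank_eq : Module.finrank ℝ V = N
  determining : ∀ ω ∈ V, (∀ i, T i ω = 0) → ω = 0

theorem IsUnisolvent.bijective (h : IsUnisolvent V T) :
    Function.Bijective ((LinearMap.pi T).domRestrict V) := by
  have := h.finite
  have hinj : Function.Injective ((LinearMap.pi T).domRestrict V) := by
    rw [injective_iff_map_eq_zero]
    intro ω hω
    exact Subtype.ext (h.determining ω ω.2 fun i => congrFun hω i)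
  have hdim : Module.finrank ℝ V = Module.finrank ℝ (Fin N → ℝ) :=
    h.finrank_eq.trans (Module.finrank_fin_fun ℝ).symm
  exact ⟨hinj, (LinearMap.injective_iff_surjective_of_finrank_eq_finrank
    (V := V) (V₂ := Fin N → ℝ) hdim).1 hinj⟩

/-- The evaluation `V ≃ ℝ^N`, `ω ↦ (T_i(ω))_i`. -/
def IsUnisolvent.evalEquiv (h : IsUnisolvent V T) : V ≃ₗ[ℝ] (Fin N → ℝ) :=
  LinearEquiv.ofBijective ((LinearMap.pi T).domRestrict V) h.bijective

/-- The Lagrange basis `ω₁, …, ω_N` of `V`, with `T_i(ω_j) = δ_{ij}`. -/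
def IsUnisolvent.lagrangeBasis (h : IsUnisolvent V T) (i : Fin N) : V :=
  h.evalEquiv.symm (Pi.single i 1)

/-- The interpolation operator `Π`: the form `Π ω` is the only element of `V` with
`T_i(Π ω) = T_i(ω)` for all `i`. -/
def IsUnisolvent.interpolation (h : IsUnisolvent V T) : TestForm k E →ₗ[ℝ] V :=
  h.evalEquiv.symm.toLinearMap ∘ₗ LinearMap.pi T

theorem IsUnisolvent.apply_interpolation (h : IsUnisolvent V T) (ω : TestForm k E) (i : Fin N) :
    T i (h.interpolation ω) = T i ω :=
  congrFun (h.evalEquiv.apply_symm_apply (LinearMap.pi T ω)) i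

theorem IsUnisolvent.apply_lagrangeBasis (h : IsUnisolvent V T) (i j : Fin N) :
    T i (h.lagrangeBasis j) = if i = j then 1 else 0 :=
  (congrFun (h.evalEquiv.apply_symm_apply (Pi.single j 1)) i).trans (Pi.single_apply j 1 i)

/-- The operator norm `sup {‖L ω‖₀ / ‖ω‖₀ : ‖ω‖₀ ≠ 0}`. -/
def opNorm (L : TestForm k E →ₗ[ℝ] V) : ℝ≥0∞ :=
  ⨆ (ω : TestForm k E) (_ : norm0 ω ≠ 0), norm0 (L ω : TestForm k E) / norm0 ω

/-- The Lebesgue constant `sup_{T ∈ 𝒜^k(E)} ∑_i |T(ω_i)|`. -/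
def IsUnisolvent.lebesgueConstant (h : IsUnisolvent V T) : ℝ≥0∞ :=
  ⨆ A ∈ averagingCurrents k E, ∑ i, ENNReal.ofReal |A (h.lagrangeBasis i : TestForm k E)|

end Interpolation

end IntegralInterpolation

end

open IntegralInterpolation

noncomputable section

namespace IntegralInterpolation

variable {n k : ℕ} {E S : Set (Rn n)} {τ : Rn n → KVector n k}

/-! ### Measurability and integrability along oriented rectifiable sets -/

/-! Since `norm0 ω` is the supremum of `|A ω|` over averaging currents `A` (`norm0_eq_iSup`),
everything rests on the identity `A(Πω) = ∑ T_i(ω) A(ω_i)`. Each `T_i` is itself an averaging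
current, so `|T_i ω| ≤ ‖ω‖₀`, which gives the upper bound; finiteness follows from `𝓛 ≤ ∑ ‖ω_i‖₀`
and the boundedness of continuous forms on the compact set `E`. For the reverse inequality, fix `A`
and look for a form of norm at most one with `T_i(ω)` close to the sign of `A(ω_i)`; then `A(Πω)` is
close to `∑ |A(ω_i)|`. The set `S_i` behind `T_i` lies in the support of `T_i` up to a null set
(`measure_diff_currentSupport`), so the `S_i` are essentially disjoint and the field equal to `±
τ_i` on `S_i` has norm at most one. An `L¹` approximation by a continuous field, retracted onto the
unit ball, yields the form (`exists_form_apply_near_sign`). -/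

theorem TestForm.extend_apply (ω : TestForm k E) {x : Rn n} (hx : x ∈ E) :
    ω.extend x = ω ⟨x, hx⟩ :=
  Subtype.val_injective.extend_apply ω 0 ⟨x, hx⟩

theorem TestForm.continuousOn_extend (ω : TestForm k E) : ContinuousOn ω.extend E := by
  rw [continuousOn_iff_continuous_domRestrict]
  convert ω.continuous using 1
  ext1 x
  exact ω.extend_apply x.2

theorem TestForm.exists_norm_le (hE : IsCompact E) (ω : TestForm k E) :
    ∃ C : ℝ, 0 ≤ C ∧ ∀ x, ‖ω x‖ ≤ C := by
  have := isCompact_iff_compactSpace.1 hE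
  exact ⟨‖ω‖, norm_nonneg ω, ω.norm_coe_le_norm⟩

namespace IsOrientedRectifiable

theorem ae_norm_eq_one (h : IsOrientedRectifiable k E S τ) :
    ∀ᵐ x ∂μHE[k].restrict S, ‖τ x‖ = 1 := by
  obtain ⟨R, M, -, -, -, -, -, hnull, -, hR⟩ := h.orientation
  rw [ae_restrict_iff'₀ h.nullMeasurable]
  filter_upwards [measure_eq_zero_iff_ae_notMem.1 hnull] with x hx hxS
  obtain ⟨j, hj⟩ := Set.mem_iUnion.1 (not_not.1 fun hxR => hx ⟨hxS, hxR⟩)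
  exact (hR j x hj).1

theorem aestronglyMeasurable (h : IsOrientedRectifiable k E S τ) :
    AEStronglyMeasurable τ (μHE[k].restrict S) := by
  obtain ⟨R, M, -, -, hmeas, -, hRS, hnull, hcont, -⟩ := h.orientation
  -- The regular part is only null-measurable, whereas measurability from `ContinuousOn` needs a
  -- measurable set; a measurable subset of full measure serves.
  obtain ⟨R', hR', hR'm, hR'e⟩ :=
    (NullMeasurableSet.iUnion hmeas).exists_measurable_subset_ae_eq
  have hS : S =ᵐ[μHE[k]] R' := by
    refine Filter.EventuallyEq.trans ?_ hR'e.symm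
    exact Filter.EventuallyLE.antisymm (ae_le_set.2 hnull)
      (Set.iUnion_subset hRS).eventuallyLE
  rw [Measure.restrict_congr_set hS]
  exact (hcont.mono hR').aestronglyMeasurable hR'm

theorem measure_ne_top (h : IsOrientedRectifiable k E S τ) :
    (μHE[k] : Measure (Rn n)) S ≠ ∞ := h.measure_lt_top.ne

theorem toReal_measure_pos (h : IsOrientedRectifiable k E S τ) :
    0 < ((μHE[k] : Measure (Rn n)) S).toReal :=
  ENNReal.toReal_pos h.measure_pos.ne' h.measure_ne_top

theorem integrableOn (h : IsOrientedRectifiable k E S τ) : IntegrableOn τ S μHE[k] :=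
  IntegrableOn.of_bound h.measure_lt_top h.aestronglyMeasurable 1
    (h.ae_norm_eq_one.mono fun _ hx => hx.le)

theorem ae_norm_extend_apply_le (h : IsOrientedRectifiable k E S τ) (ω : TestForm k E) {C : ℝ}
    (hω : ∀ x, ‖ω x‖ ≤ C) : ∀ᵐ x ∂μHE[k].restrict S, ‖ω.extend x (τ x)‖ ≤ C := by
  filter_upwards [h.ae_norm_eq_one, ae_restrict_mem₀ h.nullMeasurable] with x hx hxS
  rw [ω.extend_apply (h.subset hxS)]
  calc _ ≤ ‖ω ⟨x, h.subset hxS⟩‖ * ‖τ x‖ := ContinuousLinearMap.le_opNorm _ _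
    _ ≤ C := by rw [hx, mul_one]; exact hω _

theorem integrableOn_extend_apply (h : IsOrientedRectifiable k E S τ) (hE : IsCompact E)
    (ω : TestForm k E) : IntegrableOn (fun x => ω.extend x (τ x)) S μHE[k] := by
  obtain ⟨C, -, hC⟩ := ω.exists_norm_le hE
  refine IntegrableOn.of_bound h.measure_lt_top ?_ C (h.ae_norm_extend_apply_le ω hC)
  have hω : AEStronglyMeasurable ω.extend (μHE[k].restrict S) :=
    (ω.continuousOn_extend.aestronglyMeasurable hE.measurableSet).mono_measure
      (Measure.restrict_mono_set _ h.subset)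
  -- The identity of the dual, read as a bilinear map, is the pairing.
  exact (ContinuousLinearMap.id ℝ (KCovector n k)).aestronglyMeasurable_comp₂ hω
    h.aestronglyMeasurable

theorem abs_formIntegral_le (h : IsOrientedRectifiable k E S τ) (ω : TestForm k E) {C : ℝ}
    (hω : ∀ x, ‖ω x‖ ≤ C) :
    |formIntegral S τ ω| ≤ C * ((μHE[k] : Measure (Rn n)) S).toReal :=
  norm_setIntegral_le_of_norm_le_const_ae h.measure_lt_top (h.ae_norm_extend_apply_le ω hω)

/-- The averaging current of an oriented rectifiable set. -/
def current (h : IsOrientedRectifiable k E S τ) (hE : IsCompact E) : TestForm k E →ₗ[ℝ] ℝ where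
  toFun ω := ((μHE[k] : Measure (Rn n)) S).toReal⁻¹ * formIntegral S τ ω
  map_add' ω η := by
    rw [← mul_add, formIntegral, formIntegral, formIntegral,
      ← integral_add (h.integrableOn_extend_apply hE ω) (h.integrableOn_extend_apply hE η)]
    congr 1
    refine integral_congr_ae ?_
    filter_upwards [ae_restrict_mem₀ h.nullMeasurable] with x hx
    simp [TestForm.extend_apply _ (h.subset hx)]
  map_smul' c ω := by
    rw [RingHom.id_apply, smul_eq_mul, mul_left_comm, formIntegral, formIntegral,
      ← integral_const_mul c]
    congr 1
    refine integral_congr_ae ?_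
    filter_upwards [ae_restrict_mem₀ h.nullMeasurable] with x hx
    simp [TestForm.extend_apply _ (h.subset hx)]

theorem current_mem (h : IsOrientedRectifiable k E S τ) (hE : IsCompact E) :
    h.current hE ∈ averagingCurrents k E :=
  ⟨S, τ, h, fun _ => rfl⟩

theorem ofReal_abs_average (h : IsOrientedRectifiable k E S τ) (ω : TestForm k E) :
    ENNReal.ofReal |((μHE[k] : Measure (Rn n)) S).toReal⁻¹ * formIntegral S τ ω| =
      ENNReal.ofReal |formIntegral S τ ω| / (μHE[k] : Measure (Rn n)) S := by
  rw [abs_mul, abs_of_pos (inv_pos.2 h.toReal_measure_pos), mul_comm, ← div_eq_mul_inv,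
    ENNReal.ofReal_div_of_pos h.toReal_measure_pos, ENNReal.ofReal_toReal h.measure_ne_top]

end IsOrientedRectifiable

/-! ### The norm `‖ω‖₀` through averaging currents -/

/-- This puts the norm and the Lebesgue constant over the same index set. Compactness gives the
integrability that makes averages linear functionals. -/
theorem norm0_eq_iSup (hE : IsCompact E) (ω : TestForm k E) :
    norm0 ω = ⨆ A ∈ averagingCurrents k E, ENNReal.ofReal |A ω| := by
  apply le_antisymm
  · refine iSup_le fun S => iSup_le fun τ => iSup_le fun h => ?_
    rw [← h.ofReal_abs_average ω]
    exact le_iSup₂_of_le (h.current hE) (h.current_mem hE) le_rfl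
  · refine iSup₂_le ?_
    rintro A ⟨S, τ, h, hA⟩
    rw [hA, h.ofReal_abs_average]
    exact le_iSup_of_le S (le_iSup_of_le τ (le_iSup_of_le h le_rfl))

theorem ofReal_abs_le_norm0 (hE : IsCompact E) {A : TestForm k E →ₗ[ℝ] ℝ}
    (hA : A ∈ averagingCurrents k E) (ω : TestForm k E) : ENNReal.ofReal |A ω| ≤ norm0 ω := by
  rw [norm0_eq_iSup hE]
  exact le_iSup₂_of_le A hA le_rfl

theorem abs_apply_le_of_mem_averagingCurrents {A : TestForm k E →ₗ[ℝ] ℝ}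
    (hA : A ∈ averagingCurrents k E) (ω : TestForm k E) {C : ℝ} (hω : ∀ x, ‖ω x‖ ≤ C) :
    |A ω| ≤ C := by
  obtain ⟨S, τ, h, hA⟩ := hA
  rw [hA, abs_mul, abs_of_pos (inv_pos.2 h.toReal_measure_pos), inv_mul_le_iff₀
    h.toReal_measure_pos, mul_comm]
  exact h.abs_formIntegral_le ω hω

theorem norm0_le (hE : IsCompact E) (ω : TestForm k E) {C : ℝ} (hω : ∀ x, ‖ω x‖ ≤ C) :
    norm0 ω ≤ ENNReal.ofReal C := by
  rw [norm0_eq_iSup hE]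
  exact iSup₂_le fun A hA =>
    ENNReal.ofReal_le_ofReal (abs_apply_le_of_mem_averagingCurrents hA ω hω)

theorem norm0_lt_top (hE : IsCompact E) (ω : TestForm k E) : norm0 ω < ∞ := by
  obtain ⟨C, -, hC⟩ := ω.exists_norm_le hE
  exact (norm0_le hE ω hC).trans_lt ENNReal.ofReal_lt_top

/-! ### The support of an averaging current -/

/-- An averaging current that vanishes on all forms supported in the trace on `E` of an open set
`U` comes from a set that does not charge `U`. -/
theorem IsOrientedRectifiable.measure_inter_eq_zero (h : IsOrientedRectifiable k E S τ)
    {U : Set (Rn n)} (hU : IsOpen U)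
    (hzero : ∀ ω : TestForm k E, tsupport ω ⊆ Subtype.val ⁻¹' U → formIntegral S τ ω = 0) :
    (μHE[k] : Measure (Rn n)) (S ∩ U) = 0 := by
  have key : ∀ᵐ x ∂μHE[k].restrict S, x ∈ U → τ x = 0 := by
    refine hU.ae_eq_zero_of_integral_contDiff_smul_eq_zero
      ((Integrable.locallyIntegrable h.integrableOn).locallyIntegrableOn U) fun g hg hgc hgU => ?_
    have hint : Integrable (fun x => g x • τ x) (μHE[k].restrict S) := by
      obtain ⟨C, hC⟩ := hgc.exists_bound_of_continuous hg.continuous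
      exact Integrable.bdd_smul h.integrableOn C hg.continuous.aestronglyMeasurable
        (Filter.Eventually.of_forall hC)
    -- Testing with the form `g ⟨c, ·⟩` gives `⟨c, c⟩ = 0`, so scalar bumps `g` suffice for the
    -- vector field `τ`.
    set c := ∫ x in S, g x • τ x ∂μHE[k] with hc
    have hcont : Continuous fun x : E => g x • (innerSL ℝ c : KCovector n k) :=
      (hg.continuous.comp continuous_subtype_val).smul continuous_const
    have h0 := hzero ⟨_, hcont⟩ <| by
      refine (closure_minimal ?_ ((isClosed_tsupport g).preimage continuous_subtype_val)).trans
        (Set.preimage_mono hgU)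
      intro x hx
      exact subset_tsupport g fun hgx => hx (by simp [hgx])
    rw [← inner_self_eq_zero (𝕜 := ℝ), ← h0, formIntegral]
    nth_rewrite 2 [hc]
    rw [← integral_inner hint]
    refine integral_congr_ae ?_
    filter_upwards [ae_restrict_mem₀ h.nullMeasurable] with x hx
    simp [TestForm.extend_apply _ (h.subset hx), inner_smul_right]
  -- A unit vector field cannot vanish, so `τ = 0` on `S ∩ U` forces that set to be null.
  have hnot : ∀ᵐ x ∂μHE[k].restrict S, x ∉ U := by
    filter_upwards [key, h.ae_norm_eq_one] with x hx hx1 hxU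
    simp [hx hxU] at hx1
  rw [ae_restrict_iff'₀ h.nullMeasurable] at hnot
  rw [measure_eq_zero_iff_ae_notMem]
  exact hnot.mono fun x hx hxm => hx hxm.1 hxm.2

/-- Every point of `S` off the support has a neighbourhood that `S` does not charge, and in a second
countable space locally null sets are null. -/
theorem IsOrientedRectifiable.measure_diff_currentSupport (h : IsOrientedRectifiable k E S τ)
    {A : TestForm k E →ₗ[ℝ] ℝ}
    (hA : ∀ ω, A ω = ((μHE[k] : Measure (Rn n)) S).toReal⁻¹ * formIntegral S τ ω) :
    (μHE[k] : Measure (Rn n)) (S \ currentSupport A) = 0 := by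
  refine measure_null_of_locally_null _ fun x hx => ?_
  have hxE := h.subset hx.1
  have hx' : (⟨x, hxE⟩ : E) ∈ ⋃₀ {B : Set E | IsOpen B ∧
      ∀ ω : TestForm k E, tsupport ω ⊆ B → A ω = 0} := by
    by_contra hcon
    exact hx.2 ⟨⟨x, hxE⟩, hcon, rfl⟩
  obtain ⟨B, ⟨hB, hB0⟩, hxB⟩ := hx'
  obtain ⟨U, hU, rfl⟩ := isOpen_induced_iff.1 hB
  refine ⟨S ∩ U, ?_, h.measure_inter_eq_zero hU fun ω hω => ?_⟩
  · exact mem_nhdsWithin.2 ⟨U, hU, hxB, fun y hy => ⟨hy.2.1, hy.1⟩⟩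
  · have := hB0 ω hω
    rw [hA] at this
    exact (mul_eq_zero.1 this).resolve_left (inv_pos.2 h.toReal_measure_pos).ne'

/-! ### Forms with prescribed averages -/

/-- The radial retraction of a normed space onto its closed unit ball. -/
def ballRetraction {F : Type*} [NormedAddCommGroup F] [NormedSpace ℝ F] (x : F) : F :=
  (max 1 ‖x‖)⁻¹ • x

section ballRetraction

variable {F : Type*} [NormedAddCommGroup F] [NormedSpace ℝ F]

theorem continuous_ballRetraction : Continuous (ballRetraction : F → F) := by
  refine Continuous.smul (Continuous.inv₀ (by fun_prop) fun x => ?_) continuous_id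
  exact (lt_max_of_lt_left one_pos).ne'

theorem norm_ballRetraction_le (x : F) : ‖ballRetraction x‖ ≤ 1 := by
  have hpos : 0 < max 1 ‖x‖ := lt_max_of_lt_left one_pos
  rw [ballRetraction, norm_smul, norm_inv, Real.norm_of_nonneg hpos.le, inv_mul_le_iff₀ hpos,
    mul_one]
  exact le_max_right _ _

/-- The retraction moves `x` by its distance to the unit ball, hence by at most `‖y - x‖`; the
triangle inequality through `x` gives the factor 2. -/
theorem norm_sub_ballRetraction_le {x y : F} (hy : ‖y‖ ≤ 1) :
    ‖y - ballRetraction x‖ ≤ 2 * ‖y - x‖ := by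
  have hx : ‖x - ballRetraction x‖ ≤ ‖y - x‖ := by
    rcases le_total ‖x‖ 1 with h | h
    · simp [ballRetraction, max_eq_left h]
    · have hpos : 0 < ‖x‖ := one_pos.trans_le h
      have : x - ballRetraction x = (1 - ‖x‖⁻¹) • x := by
        rw [ballRetraction, max_eq_right h, sub_smul, one_smul]
      rw [this, norm_smul, Real.norm_of_nonneg (sub_nonneg.2 (inv_le_one_of_one_le₀ h)), sub_mul,
        inv_mul_cancel₀ hpos.ne', one_mul, norm_sub_rev]
      linarith [norm_sub_norm_le x y]
  calc ‖y - ballRetraction x‖ ≤ ‖y - x‖ + ‖x - ballRetraction x‖ :=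
        norm_sub_le_norm_sub_add_norm_sub ..
    _ ≤ 2 * ‖y - x‖ := by linarith

end ballRetraction

/-- If finitely many averaging currents have supports that are pairwise essentially disjoint, then
any choice of signs is approximated by their values at a continuous form of norm at most one. -/
theorem exists_form_apply_near_sign {ι : Type*} [Fintype ι]
    {T : ι → TestForm k E →ₗ[ℝ] ℝ} (hE : IsCompact E) (hT : ∀ i, T i ∈ averagingCurrents k E)
    (hdisj : ∀ i j, i ≠ j →
      (μHE[k] : Measure (Rn n)) (currentSupport (T i) ∩ currentSupport (T j)) = 0)
    (s : ι → ℝ) (hs : ∀ i, |s i| = 1) {ε : ℝ} (hε : 0 < ε) :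
    ∃ ω : TestForm k E, (∀ x, ‖ω x‖ ≤ 1) ∧ ∀ i, |T i ω - s i| ≤ ε := by
  classical
  choose S τ h hTS using hT
  have hSdisj : ∀ i j, i ≠ j → (μHE[k] : Measure (Rn n)) (S i ∩ S j) = 0 := fun i j hij => by
    refine measure_mono_null (t := (currentSupport (T i) ∩ currentSupport (T j)) ∪
      ((S i \ currentSupport (T i)) ∪ (S j \ currentSupport (T j)))) (fun x hx => ?_)
      (measure_union_null (hdisj i j hij) (measure_union_null
        ((h i).measure_diff_currentSupport (hTS i)) ((h j).measure_diff_currentSupport (hTS j))))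
    by_cases hi : x ∈ currentSupport (T i) <;> by_cases hj : x ∈ currentSupport (T j) <;>
      simp [hi, hj, hx.1, hx.2]
  let f : Rn n → KVector n k := fun x => ∑ i, (S i).indicator (fun y => s i • τ i y) x
  have hf : Integrable f μHE[k] := integrable_finsetSum _ fun i _ => by
    have hae := (h i).nullMeasurable.toMeasurable_ae_eq
    refine Integrable.congr ?_ (indicator_ae_eq_of_ae_eq_set hae)
    rw [integrable_indicator_iff (measurableSet_toMeasurable _ _), IntegrableOn,
      Measure.restrict_congr_set hae]
    exact (h i).integrableOn.smul (s i)
  have hfS : ∀ i, ∀ᵐ x ∂μHE[k].restrict (S i), f x = s i • τ i x := fun i => by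
    rw [ae_restrict_iff'₀ (h i).nullMeasurable]
    have hae : ∀ᵐ x ∂(μHE[k] : Measure (Rn n)), ∀ j, i ≠ j → x ∉ S i ∩ S j :=
      ae_all_iff.2 fun j => by
        by_cases hij : i = j
        · simp [hij]
        · filter_upwards [measure_eq_zero_iff_ae_notMem.1 (hSdisj i j hij)] with x hx _ using hx
    filter_upwards [hae] with x hx hxi
    refine (Finset.sum_eq_single i (fun j _ hji => ?_) (by simp)).trans
      (Set.indicator_of_mem hxi _)
    exact Set.indicator_of_notMem (fun hxj => hx j hji.symm ⟨hxi, hxj⟩) _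
  -- Restriction to `W` makes the Hausdorff measure finite, hence regular enough for `L¹`
  -- approximation by continuous functions.
  let W : Set (Rn n) := ⋃ i, S i
  have : IsFiniteMeasure ((μHE[k] : Measure (Rn n)).restrict W) :=
    isFiniteMeasure_restrict.2 <| ne_top_of_le_ne_top
      (ENNReal.sum_ne_top.2 fun i _ => (h i).measure_ne_top) (measure_iUnion_fintype_le _ S)
  obtain ⟨m, hm, hmS⟩ : ∃ m : ℝ, 0 < m ∧ ∀ i, m ≤ ((μHE[k] : Measure (Rn n)) (S i)).toReal := by
    rcases isEmpty_or_nonempty ι with hι | hι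
    · exact ⟨1, one_pos, fun i => hι.elim i⟩
    · obtain ⟨i₀, hi₀⟩ := Finite.exists_min fun i => ((μHE[k] : Measure (Rn n)) (S i)).toReal
      exact ⟨_, (h i₀).toReal_measure_pos, hi₀⟩
  -- The 2 absorbs the loss in the retraction, and `m` the division by the measure of `S i`.
  obtain ⟨g, hg, hgint⟩ :=
    (hf.restrict (s := W)).exists_boundedContinuous_integral_sub_le (ε := ε * m / 2) (by positivity)
  have hcont : Continuous fun x : E => (innerSL ℝ (ballRetraction (g x)) : KCovector n k) :=
    (innerSL ℝ).continuous.comp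
      (continuous_ballRetraction.comp (g.continuous.comp continuous_subtype_val))
  let ω : TestForm k E := ⟨_, hcont⟩
  refine ⟨ω, fun x => (innerSL_apply_norm (𝕜 := ℝ) _).trans_le (norm_ballRetraction_le _),
    fun i => ?_⟩
  have hpos := (h i).toReal_measure_pos
  have hSW : S i ⊆ W := Set.subset_iUnion S i
  have hfg : IntegrableOn (fun x => ‖f x - g x‖) W μHE[k] := (hf.restrict.sub hgint).norm
  have hsub : T i ω - s i = ((μHE[k] : Measure (Rn n)) (S i)).toReal⁻¹ *
      ∫ x in S i, (ω.extend x (τ i x) - s i) ∂μHE[k] := by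
    have : IsFiniteMeasure ((μHE[k] : Measure (Rn n)).restrict (S i)) :=
      isFiniteMeasure_restrict.2 (h i).measure_ne_top
    rw [integral_sub ((h i).integrableOn_extend_apply hE ω) (integrable_const _), hTS, formIntegral,
      mul_sub, setIntegral_const, smul_eq_mul, measureReal_def, inv_mul_cancel_left₀ hpos.ne']
  have hbound : ‖∫ x in S i, (ω.extend x (τ i x) - s i) ∂μHE[k]‖ ≤
      ∫ x in S i, 2 * ‖f x - g x‖ ∂μHE[k] := by
    refine norm_integral_le_of_norm_le ((hfg.mono_set hSW).const_mul 2) ?_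
    filter_upwards [hfS i, (h i).ae_norm_eq_one, ae_restrict_mem₀ (h i).nullMeasurable]
      with x hfx hτx hxS
    have hfx1 : ‖f x‖ ≤ 1 := by rw [hfx, norm_smul, hτx, Real.norm_eq_abs, hs, one_mul]
    -- Here `s i = ⟨f x, τ i x⟩`, because `f x = s i • τ i x` with `τ i x` a unit vector.
    have hinner : ω.extend x (τ i x) - s i =
        inner ℝ (ballRetraction (g x) - f x) (τ i x) := by
      rw [ω.extend_apply ((h i).subset hxS), inner_sub_left, hfx, real_inner_smul_left,
        real_inner_self_eq_norm_sq, hτx]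
      simp [ω]
    rw [hinner]
    refine (norm_inner_le_norm _ _).trans ?_
    rw [hτx, mul_one, norm_sub_rev]
    exact norm_sub_ballRetraction_le hfx1
  have hWint : ∫ x in S i, 2 * ‖f x - g x‖ ∂μHE[k] ≤ ε * m := by
    rw [integral_const_mul]
    have := setIntegral_mono_set hfg (Filter.Eventually.of_forall fun x => norm_nonneg _)
      hSW.eventuallyLE
    linarith
  rw [hsub, abs_mul, abs_of_pos (inv_pos.2 hpos), inv_mul_le_iff₀ hpos]
  calc _ ≤ ε * m := hbound.trans hWint
    _ ≤ _ := by rw [mul_comm]; exact mul_le_mul_of_nonneg_right (hmS i) hε.le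

/-! ### The interpolation operator -/

section Interpolation

variable {N : ℕ} {V : Submodule ℝ (TestForm k E)} {T : Fin N → TestForm k E →ₗ[ℝ] ℝ}

namespace IsUnisolvent

theorem interpolation_eq_sum (hU : IsUnisolvent V T) (ω : TestForm k E) :
    hU.interpolation ω = ∑ i, T i ω • hU.lagrangeBasis i := by
  apply hU.evalEquiv.injective
  rw [map_sum]
  ext i
  simp [interpolation, lagrangeBasis, Finset.sum_apply, Pi.single_apply]

theorem apply_interpolation_eq_sum (hU : IsUnisolvent V T) (A : TestForm k E →ₗ[ℝ] ℝ)
    (ω : TestForm k E) :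
    A (hU.interpolation ω) = ∑ i, T i ω * A (hU.lagrangeBasis i) := by
  rw [hU.interpolation_eq_sum]
  simp

theorem lebesgueConstant_lt_top (hU : IsUnisolvent V T) (hE : IsCompact E) :
    hU.lebesgueConstant < ∞ := by
  have hle : hU.lebesgueConstant ≤ ∑ i, norm0 (hU.lagrangeBasis i : TestForm k E) :=
    iSup₂_le fun A hA => Finset.sum_le_sum fun i _ => ofReal_abs_le_norm0 hE hA _
  exact hle.trans_lt (ENNReal.sum_lt_top.2 fun i _ => norm0_lt_top hE _)

theorem norm0_interpolation_le (hU : IsUnisolvent V T) (hE : IsCompact E)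
    (hT : ∀ i, T i ∈ averagingCurrents k E) (ω : TestForm k E) :
    norm0 (hU.interpolation ω : TestForm k E) ≤ hU.lebesgueConstant * norm0 ω := by
  rw [norm0_eq_iSup hE]
  refine iSup₂_le fun A hA => ?_
  calc ENNReal.ofReal |A (hU.interpolation ω)|
      ≤ ENNReal.ofReal (∑ i, |A (hU.lagrangeBasis i)| * |T i ω|) := by
        refine ENNReal.ofReal_le_ofReal ?_
        rw [hU.apply_interpolation_eq_sum]
        refine (Finset.abs_sum_le_sum_abs _ _).trans_eq (Finset.sum_congr rfl fun i _ => ?_)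
        rw [abs_mul, mul_comm]
    _ = ∑ i, ENNReal.ofReal |A (hU.lagrangeBasis i)| * ENNReal.ofReal |T i ω| := by
        rw [ENNReal.ofReal_sum_of_nonneg fun i _ => by positivity]
        exact Finset.sum_congr rfl fun i _ => ENNReal.ofReal_mul (abs_nonneg _)
    _ ≤ ∑ i, ENNReal.ofReal |A (hU.lagrangeBasis i)| * norm0 ω := by
        gcongr with i
        exact ofReal_abs_le_norm0 hE (hT i) ω
    _ ≤ hU.lebesgueConstant * norm0 ω := by
        rw [← Finset.sum_mul]
        gcongr
        exact le_iSup₂_of_le A hA le_rfl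

theorem opNorm_interpolation_le (hU : IsUnisolvent V T) (hE : IsCompact E)
    (hT : ∀ i, T i ∈ averagingCurrents k E) :
    opNorm hU.interpolation ≤ hU.lebesgueConstant :=
  iSup₂_le fun ω _ => ENNReal.div_le_of_le_mul (hU.norm0_interpolation_le hE hT ω)

theorem norm0_interpolation_le_opNorm_mul (hU : IsUnisolvent V T) (hE : IsCompact E)
    (hT : ∀ i, T i ∈ averagingCurrents k E) (ω : TestForm k E) :
    norm0 (hU.interpolation ω : TestForm k E) ≤ opNorm hU.interpolation * norm0 ω := by
  by_cases h0 : norm0 ω = 0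
  -- `opNorm` ignores forms of zero norm; for these the bound by the Lebesgue constant already gives
  -- `‖Πω‖₀ = 0`.
  · simpa [h0] using hU.norm0_interpolation_le hE hT ω
  · rw [← ENNReal.div_le_iff h0 (norm0_lt_top hE ω).ne]
    exact le_iSup₂_of_le ω h0 le_rfl

theorem lebesgueConstant_le_opNorm (hU : IsUnisolvent V T) (hE : IsCompact E)
    (hT : ∀ i, T i ∈ averagingCurrents k E)
    (hdisj : ∀ i j, i ≠ j →
      (μHE[k] : Measure (Rn n)) (currentSupport (T i) ∩ currentSupport (T j)) = 0) :
    hU.lebesgueConstant ≤ opNorm hU.interpolation := by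
  refine iSup₂_le fun A hA => ?_
  set a : Fin N → ℝ := fun i => A (hU.lagrangeBasis i) with ha
  have hfin : opNorm hU.interpolation ≠ ∞ :=
    ((hU.opNorm_interpolation_le hE hT).trans_lt (hU.lebesgueConstant_lt_top hE)).ne
  rw [← ENNReal.ofReal_sum_of_nonneg fun i _ => abs_nonneg _]
  refine ENNReal.ofReal_le_of_le_toReal (le_of_forall_pos_le_add fun δ hδ => ?_)
  set B := ∑ i, |a i| with hB
  have hB0 : 0 ≤ B := Finset.sum_nonneg fun i _ => abs_nonneg _
  -- The value at zero is 1 rather than 0, to keep `|s i| = 1`.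
  let s : Fin N → ℝ := fun i => if 0 ≤ a i then 1 else -1
  have hs : ∀ i, |s i| = 1 := fun i => by
    simp only [s]; split_ifs <;> simp
  have hsa : ∀ i, s i * a i = |a i| := fun i => by
    simp only [s]
    split_ifs with hi
    · rw [one_mul, abs_of_nonneg hi]
    · rw [abs_of_neg (not_le.1 hi), neg_one_mul]
  -- The errors in the signs are weighted by `|a i|` and add up to at most `δ B / (B + 1) ≤ δ`; the
  -- `+ 1` covers `B = 0`.
  obtain ⟨ω, hω, hTω⟩ := exists_form_apply_near_sign hE hT hdisj s hs
    (ε := δ / (B + 1)) (by positivity)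
  have hnorm : norm0 ω ≤ 1 := by simpa using norm0_le hE ω hω
  have hAω : |A (hU.interpolation ω)| ≤ (opNorm hU.interpolation).toReal := by
    rw [← ENNReal.ofReal_le_iff_le_toReal hfin]
    exact (ofReal_abs_le_norm0 hE hA _).trans
      ((hU.norm0_interpolation_le_opNorm_mul hE hT ω).trans (mul_le_of_le_one_right' hnorm))
  have hdiff : |B - A (hU.interpolation ω)| ≤ δ := by
    rw [hU.apply_interpolation_eq_sum, hB, ← Finset.sum_sub_distrib]
    calc _ ≤ ∑ i, |(|a i| - T i ω * a i)| := Finset.abs_sum_le_sum_abs _ _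
      _ ≤ ∑ i, δ / (B + 1) * |a i| := Finset.sum_le_sum fun i _ => by
        have : |a i| - T i ω * a i = (s i - T i ω) * a i := by rw [sub_mul, hsa]
        rw [this, abs_mul, abs_sub_comm]
        exact mul_le_mul_of_nonneg_right (hTω i) (abs_nonneg _)
      _ = δ * (B / (B + 1)) := by rw [← Finset.mul_sum, ← hB]; ring
      _ ≤ δ := mul_le_of_le_one_right hδ.le (div_le_one_of_le₀ (by linarith) (by linarith))
  linarith [(abs_le.1 hdiff).2, le_abs_self (A (hU.interpolation ω))]

end IsUnisolvent

end Interpolation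

end IntegralInterpolation

end

theorem mainTheorem1 {n k N : ℕ} (hk : k ≤ n) (Ω : Set (Rn n)) (hΩ : IsBoundedLipschitzDomain Ω)
    (V : Submodule ℝ (TestForm k (closure Ω)))
    (T : Fin N → TestForm k (closure Ω) →ₗ[ℝ] ℝ)
    (hT : ∀ i, T i ∈ averagingCurrents k (closure Ω))
    (hU : IsUnisolvent V T) :
    hU.lebesgueConstant < ∞ ∧
    opNorm hU.interpolation ≤ hU.lebesgueConstant ∧
    ((∀ i j, i ≠ j →
        (μHE[k] : Measure (Rn n)) (currentSupport (T i) ∩ currentSupport (T j)) = 0) →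
      opNorm hU.interpolation = hU.lebesgueConstant) := by
  have hE : IsCompact (closure Ω) := hΩ.isBounded.isCompact_closure
  refine ⟨hU.lebesgueConstant_lt_top hE, hU.opNorm_interpolation_le hE hT, fun hdisj => ?_⟩
  exact (hU.opNorm_interpolation_le hE hT).antisymm (hU.lebesgueConstant_le_opNorm hE hT hdisj)
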